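/- **Theorem.** Let $\alpha\le\beta$ be real. Let $\mathbf N[\alpha,\beta]$ be the class of Markov functions $\varphi(\lambda)=\int_\alpha^\beta\frac{d\sigma(t)}{t-\lambda}$, $\lambda\in\mathbb C\setminus[\alpha,\beta]$, with $\sigma$ a finite positive Borel measure on $[\alpha,\beta]$, and let $\mathbf N^0[\alpha,\beta]=\mathbf N[\alpha,\beta]\cup\{0\}$. Let $n\ge 0$, let $z_0,\dots,z_n$ be distinct points of the open upper half plane, let $w_0,\dots,w_n\in\mathbb C$, and call $\varphi\in\mathbf N[\alpha,\beta]$ a solution of the problem $\mathbf{NP}([\alpha,\beta],n)$ if $\varphi(z_k)=w_k$ for $k=0,\dots,n$. Fix arbitrary normalizing numbers $b_0,\dots,b_n>0$. Put $w_k^{(0)}=w_k$ $(0\le k\le n)$ and, for $j=0,1,\dots,n$, as long as $w_j^{(j)}\ne0$, $$a_j^{(2)}=-\frac{\operatorname{Im}\bigl(1/w_j^{(j)}\bigr)}{\operatorname{Im}z_j}\in\mathbb R,\qquad a_j^{(1)}=a_j^{(2)}z_j+\frac1{w_j^{(j)}}\in\mathbb R,$$ $$w_k^{(j+1)}=-\frac{1/w_k^{(j)}+a_j^{(2)}z_k-a_j^{(1)}}{b_j^2(z_k-z_j)(z_k-\overline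 z_j)}\qquad(j<k\le n).$$ The problem is called nondegenerate if this process makes all $n+1$ steps, i.e. $w_j^{(j)}\neq0$ for $j=0,\dots,n$ (for a solvable problem this does not depend on the choice of the $b_j$, and then all the $w_k^{(j)}$ with $j\le k\le n$ are nonzero, so that the formulas make sense). In that case let $$\mathcal W_j(\lambda)=\begin{pmatrix}0&-\dfrac1{b_j(\lambda-\overline z_j)}\\ b_j(\lambda-z_j)&\dfrac{a_j^{(2)}\lambda-a_j^{(1)}}{b_j(\lambda-\overline z_j)}\end{pmatrix},\qquad (w_{il}(\lambda))_{i,l=1}^2=\mathcal W_0(\lambda)\mathcal W_1(\lambda)\cdots\mathcal W_n(\lambda).$$ If the problem is nondegenerate, then for every solution $\varphi$ there is $\tau\in\mathbf N^0[\alpha,\beta]$ such that, for all $\lambda\in\mathbb C\setminus[\alpha,\beta]$ with $\lambda\ne\overline z_0,\dots,\overline z_n$, one has $w_{21}(\lambda)\tau(\lambda)+w_{22}(\lambda)\neq0$ and $$\varphi(\lambda)=\frac{w_{11}(\lambda)\tau(\lambda)+w_{12}(\lambda)}{w_{21}(\lambda)\tau(\lambda)+w_{22}(\lambda)}.$$ 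-/

import Mathlib

open Matrix MeasureTheory

noncomputable section

/-- The class `N[α, β]` of Markov functions: functions of the form `λ ↦ ∫ dσ(t) / (t - λ)` with `σ`
a finite (positive Borel) measure concentrated on `[α, β]`. Such a function lives on
`ℂ \ [α, β]`; the values of `φ : ℂ → ℂ` on `[α, β]` play no role. -/
def IsMarkov (α β : ℝ) (φ : ℂ → ℂ) : Prop :=
  ∃ σ : Measure ℝ, IsFiniteMeasure σ ∧ σ (Set.Icc α β)ᶜ = 0 ∧
    ∀ l : ℂ, l ∉ (fun t : ℝ => (t : ℂ)) '' Set.Icc α β → φ l = ∫ t : ℝ, 1 / ((t : ℂ) - l) ∂σ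

/-- The class `N⁰[α, β] = N[α, β] ∪ {0}`. -/
def IsMarkovOrZero (α β : ℝ) (φ : ℂ → ℂ) : Prop :=
  IsMarkov α β φ ∨ ∀ l : ℂ, l ∉ (fun t : ℝ => (t : ℂ)) '' Set.Icc α β → φ l = 0

/-- `φ` solves the truncated Nevanlinna-Pick problem `NP([α, β], n)` with nodes `z 0, …, z n` and
values `w 0, …, w n` (entries of index larger than `n` are not used). -/
def SolvesNP (α β : ℝ) (n : ℕ) (z w : ℕ → ℂ) (φ : ℂ → ℂ) : Prop :=
  IsMarkov α β φ ∧ ∀ k ≤ n, φ (z k) = w k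

/-- The number `a⁽²⁾` of one step at the node `z`, for a function with value `w` at `z`. -/
def stepA2 (z w : ℂ) : ℝ := -(1 / w).im / z.im

/-- The number `a⁽¹⁾ = a⁽²⁾ z + 1 / w` of one step at the node `z`, for a function with value `w`
at `z`; it is real, see `stepA1_eq`. -/
def stepA1 (z w : ℂ) : ℝ := ((stepA2 z w : ℂ) * z + 1 / w).re

theorem stepA1_eq (z w : ℂ) (hz : z.im ≠ 0) :
    (stepA1 z w : ℂ) = (stepA2 z w : ℂ) * z + 1 / w := by
  apply Complex.ext
  · simp [stepA1]
  · rw [Complex.ofReal_im, Complex.add_im, Complex.im_ofReal_mul, stepA2, div_mul_cancel₀ _ hz]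
    ring

/-- The values `w_k^{(j)}` produced by the step-by-step process with normalizing numbers `b j`:
`w_k^{(0)} = w_k`, and `w_k^{(j+1)}` is the value at `z_k` of
`-(1 / φ_j(λ) + a_j⁽²⁾ λ - a_j⁽¹⁾) / (b_j² (λ - z_j) (λ - conj z_j))` when `φ_j(z_k) = w_k^{(j)}`.
Only the entries with `j ≤ k` are meaningful. -/
def processValue (z w : ℕ → ℂ) (b : ℕ → ℝ) : ℕ → ℕ → ℂ
  | 0, k => w k
  | j + 1, k =>
    -(1 / processValue z w b j k
        + (stepA2 (z j) (processValue z w b j j) : ℂ) * z k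
        - (stepA1 (z j) (processValue z w b j j) : ℂ))
      / ((b j : ℂ) ^ 2 * (z k - z j) * (z k - starRingEnd ℂ (z j)))

/-- The coefficient `a_j⁽²⁾` of the process. -/
def coeffA2 (z w : ℕ → ℂ) (b : ℕ → ℝ) (j : ℕ) : ℝ := stepA2 (z j) (processValue z w b j j)

/-- The coefficient `a_j⁽¹⁾` of the process. -/
def coeffA1 (z w : ℕ → ℂ) (b : ℕ → ℝ) (j : ℕ) : ℝ := stepA1 (z j) (processValue z w b j j)

/-- The problem is nondegenerate: the process does not stop before all `n + 1` steps `0, …, n` are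
made. Step `j` can be made iff the function `φ_j` reached so far is not identically zero; since a
Markov function is either identically zero or has no zeros in the upper half plane, this says that
its value `w_j^{(j)}` at `z_j` is not zero. -/
def NondegenerateNP (n : ℕ) (z w : ℕ → ℂ) (b : ℕ → ℝ) : Prop :=
  ∀ j ≤ n, processValue z w b j j ≠ 0

/-- The factor `W_j(λ)`. -/
def factorW (z w : ℕ → ℂ) (b : ℕ → ℝ) (j : ℕ) (l : ℂ) : Matrix (Fin 2) (Fin 2) ℂ :=
  !![0, -(1 / ((b j : ℂ) * (l - starRingEnd ℂ (z j))));
     (b j : ℂ) * (l - z j),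
      ((coeffA2 z w b j : ℂ) * l - (coeffA1 z w b j : ℂ)) /
        ((b j : ℂ) * (l - starRingEnd ℂ (z j)))]

/-- The ordered product `W_{[0,n]}(λ) = W_0(λ) W_1(λ) ⋯ W_n(λ)`. -/
def productW (n : ℕ) (z w : ℕ → ℂ) (b : ℕ → ℝ) (l : ℂ) : Matrix (Fin 2) (Fin 2) ℂ :=
  ((List.range (n + 1)).map fun j => factorW z w b j l).prod

end

/-! The key fact is that a Markov function `φ` not vanishing at the node satisfies `-1/φ(λ) = pλ + q
+ F(λ)` with `p`, `q` real and `F` Markov on the same interval. On `L²(σ)` write `φ(λ) = ⟪v, (A -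
λ)⁻¹ v⟫`, with `A` multiplication by `t` and `v = 1`. The Schur complement with respect to `v` and
its orthogonal complement expresses `-1/φ` through the resolvent of the compression of `A`, which
still lies between `α` and `β` (`exists_inner_resolvent_mul_eq_neg_one`). Interpolating `pλ + q + F`
at `z` and `conj z` by a real affine function and dividing the remainder by `b²(λ - z)(λ - conj z)`
only multiplies the measure by `b⁻²|t - z|⁻²`, so the quotient is again Markov
(`IsMarkov.exists_step`). Iterating over the nodes, each step being one factor acting projectively
on `(τ, 1)`, gives the parametrization. -/

/-! ### Scalar spectral measures and resolvents. -/

open scoped InnerProductSpace in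
/-- A bounded self-adjoint operator with `α ≤ T ≤ β` has, at every vector `u`, a scalar spectral
measure concentrated on `[α, β]`. -/
theorem exists_spectralMeasure {H : Type*} [NormedAddCommGroup H] [InnerProductSpace ℂ H]
    [CompleteSpace H] (T : H →L[ℂ] H) (hT : IsSelfAdjoint T) (α β : ℝ)
    (hα : algebraMap ℝ (H →L[ℂ] H) α ≤ T) (hβ : T ≤ algebraMap ℝ (H →L[ℂ] H) β) (u : H) :
    ∃ μ : Measure ℝ, IsFiniteMeasure μ ∧ μ (Set.Icc α β)ᶜ = 0 ∧
      ∀ g : ℝ → ℝ, ContinuousOn g (Set.Icc α β) → ⟪u, cfc g T u⟫_ℂ = ((∫ t, g t ∂μ : ℝ) : ℂ) := by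
  have hsub : spectrum ℝ T ⊆ Set.Icc α β := fun x hx =>
    ⟨(algebraMap_le_iff_le_spectrum hT).1 hα x hx, (le_algebraMap_iff_spectrum_le hT).1 hβ x hx⟩
  have hcpt : IsCompact (spectrum ℝ T) := ContinuousFunctionalCalculus.isCompact_spectrum T
  have : CompactSpace (spectrum ℝ T) := isCompact_iff_compactSpace.1 hcpt
  let L : C(spectrum ℝ T, ℝ) →ₗ[ℝ] ℝ :=
    { toFun := fun g => (⟪u, cfcHom hT g u⟫_ℂ).re
      map_add' := fun g h => by simp
      map_smul' := fun r g => by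
        rw [map_smul]
        simp [← Complex.coe_smul] }
  have hL : ∀ g, 0 ≤ g → 0 ≤ L g := fun g hg => by
    have h1 : 0 ≤ cfcHom hT g := cfcHom_nonneg_iff hT |>.2 hg
    have h2 := ((ContinuousLinearMap.nonneg_iff_isPositive _).1 h1).inner_nonneg_right u
    exact (Complex.nonneg_iff.1 h2).1
  let Λ : CompactlySupportedContinuousMap (spectrum ℝ T) ℝ →ₚ[ℝ] ℝ :=
    PositiveLinearMap.mk₀
      { toFun := fun g => L g.toContinuousMap
        map_add' := fun g h => L.map_add _ _
        map_smul' := fun r g => L.map_smul r _ } fun g hg => hL _ hg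
  let ν := RealRMK.rieszMeasure Λ
  have : IsFiniteMeasure ν := inferInstance
  have hme : MeasurableEmbedding ((↑) : spectrum ℝ T → ℝ) :=
    MeasurableEmbedding.subtype_coe hcpt.isClosed.measurableSet
  refine ⟨ν.map (↑), inferInstance, ?_, fun g hg => ?_⟩
  · rw [hme.map_apply]
    convert measure_empty (μ := ν)
    ext x
    simpa using hsub x.2
  · have hgc : ContinuousOn g (spectrum ℝ T) := hg.mono hsub
    have h1 := RealRMK.integral_rieszMeasure Λ ⟨⟨_, hgc.domRestrict⟩, HasCompactSupport.of_compactSpace _⟩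
    rw [hme.integral_map]
    change ∫ x : spectrum ℝ T, g x ∂ν = _ at h1
    rw [h1, cfc_apply g T hT hgc]
    have h2 : (cfcHom hT ⟨_, hgc.domRestrict⟩ : H →L[ℂ] H).toLinearMap.IsSymmetric :=
      (ContinuousLinearMap.isSelfAdjoint_iff_isSymmetric).1 (cfcHom_predicate hT _)
    have h3 := h2.coe_re_inner_self_apply u
    exact h3.symm

open scoped InnerProductSpace in
theorem inner_eq_integral_of_resolvent_eq {H : Type*} [NormedAddCommGroup H]
    [InnerProductSpace ℂ H] [CompleteSpace H] (T : H →L[ℂ] H) (hT : IsSelfAdjoint T) (α β : ℝ)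
    (hα : algebraMap ℝ (H →L[ℂ] H) α ≤ T) (hβ : T ≤ algebraMap ℝ (H →L[ℂ] H) β) (u : H) :
    ∃ μ : Measure ℝ, IsFiniteMeasure μ ∧ μ (Set.Icc α β)ᶜ = 0 ∧
      ∀ l : ℂ, l ∉ (fun t : ℝ => (t : ℂ)) '' Set.Icc α β → ∀ (k : H) (c : ℂ),
        T k - l • k = c • u → ⟪u, k⟫_ℂ = c * ∫ t : ℝ, 1 / ((t : ℂ) - l) ∂μ := by
  obtain ⟨μ, hfin, hμ, hint⟩ := exists_spectralMeasure T hT α β hα hβ u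
  have hsub : spectrum ℝ T ⊆ Set.Icc α β := fun x hx =>
    ⟨(algebraMap_le_iff_le_spectrum hT).1 hα x hx, (le_algebraMap_iff_spectrum_le hT).1 hβ x hx⟩
  refine ⟨μ, hfin, hμ, fun l hl k c hk => ?_⟩
  have hne : ∀ t ∈ Set.Icc α β, (t - l.re) ^ 2 + l.im ^ 2 ≠ 0 := fun t ht h0 => by
    have h1 : t - l.re = 0 := by nlinarith [sq_nonneg (t - l.re), sq_nonneg l.im]
    have h2 : l.im = 0 := by nlinarith [sq_nonneg (t - l.re), sq_nonneg l.im]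
    exact hl ⟨t, ht, Complex.ext (by simpa using by linarith) (by simp [h2])⟩
  -- Since `1/(t - l) = (t - Re l) g(t) + i (Im l) g(t)`, the real functional calculus is enough to
  -- describe the resolvent.
  set g : ℝ → ℝ := fun t => ((t - l.re) ^ 2 + l.im ^ 2)⁻¹ with hg
  have hgc : ContinuousOn g (Set.Icc α β) := ContinuousOn.inv₀ (by fun_prop) hne
  have hdc : ContinuousOn (fun t : ℝ => t - l.re) (Set.Icc α β) := by fun_prop
  have hpc : ContinuousOn (fun t => (t - l.re) * g t) (Set.Icc α β) := hdc.mul hgc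
  have hsc : ContinuousOn (fun t => l.im ^ 2 • g t) (Set.Icc α β) := hgc.const_smul (l.im ^ 2)
  set D := cfc (fun t : ℝ => t - l.re) T with hD
  set G := cfc g T with hG
  set P := cfc (fun t => (t - l.re) * g t) T with hP
  have hTD : T = D + algebraMap ℝ _ l.re := by
    rw [hD, cfc_sub (fun t : ℝ => t) (fun _ => l.re) T, cfc_id' ℝ T, cfc_const l.re T]
    simp
  have hPD : P * D + l.im ^ 2 • G = 1 := by
    rw [hP, hD, hG, ← cfc_mul _ _ T (hpc.mono hsub) (hdc.mono hsub),
      ← cfc_smul (l.im ^ 2) g T (hgc.mono hsub),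
      ← cfc_add T (fun t => (t - l.re) * g t * (t - l.re)) (fun t => l.im ^ 2 • g t)
        ((hpc.mul hdc).mono hsub) (hsc.mono hsub),
      ← cfc_one ℝ T]
    refine cfc_congr fun t ht => ?_
    have := hne t (hsub ht)
    simp only [hg, smul_eq_mul, Pi.one_apply]
    field_simp
  have hGD : G * D = P := by
    rw [hP, hD, hG, ← cfc_mul _ _ T (hgc.mono hsub) (hdc.mono hsub)]
    exact cfc_congr fun t ht => mul_comm _ _
  have hDk : D k = c • u + (l.im * Complex.I) • k := by
    have h1 : T k = D k + (l.re : ℂ) • k := by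
      conv_lhs => rw [hTD]
      simp [Algebra.algebraMap_eq_smul_one]
    rw [h1] at hk
    rw [← hk]
    conv_lhs => rw [← add_sub_cancel_right (D k) ((l.re : ℂ) • k)]
    conv_rhs => enter [1, 2, 1]; rw [← Complex.re_add_im l]
    module
  -- Solves `(D - i Im l) k = c u` for `k`, using `P D + (Im l)² G = 1` and `G D = P`.
  have hkk : k = c • P u + (c * (l.im * Complex.I)) • G u := by
    have h1 : P (D k) + ((l.im : ℂ) ^ 2) • G k = k := by
      simpa [← Complex.coe_smul] using congr($hPD k)
    have h2 : G (D k) = P k := congr($hGD k)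
    rw [hDk, map_add, map_smul, map_smul] at h1 h2
    rw [← h2] at h1
    nth_rw 1 [← h1]
    match_scalars <;> ring_nf
    rw [Complex.I_sq]
    ring
  have hPu := hint _ hpc
  have hGu := hint _ hgc
  rw [hkk, inner_add_right, inner_smul_right, inner_smul_right, hPu, hGu, mul_assoc, ← mul_add]
  congr 1
  have hae : ∀ᵐ t ∂μ, t ∈ Set.Icc α β := by rwa [ae_iff]
  have hbd : ∀ f : ℝ → ℝ, ContinuousOn f (Set.Icc α β) → Integrable f μ := fun f hf => by
    have h1 : μ.restrict (Set.Icc α β) = μ := Measure.restrict_eq_self_of_ae_mem hae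
    rw [← h1]
    exact hf.integrableOn_compact isCompact_Icc
  rw [← integral_complex_ofReal, ← integral_complex_ofReal, ← integral_const_mul, ← integral_add]
  · refine integral_congr_ae (hae.mono fun t ht => ?_)
    have h1 := hne t ht
    have h2 : (t : ℂ) - l ≠ 0 := fun h => hl ⟨t, ht, sub_eq_zero.1 h⟩
    rw [eq_div_iff h2]
    have h3 : ((t : ℂ) - l.re) ^ 2 + (l.im : ℂ) ^ 2 ≠ 0 := by exact_mod_cast h1
    simp only [hg]
    push_cast
    conv_lhs => enter [2, 2]; rw [← Complex.re_add_im l]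
    field_simp
    linear_combination (-(l.im : ℂ) ^ 2) * Complex.I_sq
  · exact (hbd _ hpc).ofReal
  · exact (hbd _ hgc).ofReal.const_mul _

/-! ### Reciprocals of Markov functions. -/

open scoped InnerProductSpace in
/-- Schur complement: the inverse of a scalar resolvent `⟪v, (A - λ)⁻¹ v⟫` is, up to an affine
function, a Markov function. -/
theorem exists_inner_resolvent_mul_eq_neg_one {H : Type*} [NormedAddCommGroup H]
    [InnerProductSpace ℂ H] [CompleteSpace H] (A : H →L[ℂ] H) (hA : IsSelfAdjoint A) (α β : ℝ)
    (hα : algebraMap ℝ (H →L[ℂ] H) α ≤ A) (hβ : A ≤ algebraMap ℝ (H →L[ℂ] H) β) (v : H)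
    (hv : v ≠ 0) :
    ∃ (p q : ℝ) (μ : Measure ℝ), IsFiniteMeasure μ ∧ μ (Set.Icc α β)ᶜ = 0 ∧
      ∀ l : ℂ, l ∉ (fun t : ℝ => (t : ℂ)) '' Set.Icc α β → ∀ x : H, A x - l • x = v →
        ⟪v, x⟫_ℂ * (p * l + q + ∫ t : ℝ, 1 / ((t : ℂ) - l) ∂μ) = -1 := by
  let K : Submodule ℂ H := (ℂ ∙ v)ᗮ
  let S : K →L[ℂ] H := K.subtypeL
  let T : K →L[ℂ] K := (ContinuousLinearMap.adjoint S) ∘L A ∘L S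
  have hSS : ∀ k : K, ContinuousLinearMap.adjoint S (S k) = k := fun k =>
    ext_inner_left ℂ fun w => by
      rw [ContinuousLinearMap.adjoint_inner_right]; rfl
  have hSv : ContinuousLinearMap.adjoint S v = 0 :=
    ext_inner_left ℂ fun w => by
      rw [ContinuousLinearMap.adjoint_inner_right, inner_zero_right]
      exact Submodule.mem_orthogonal' _ _ |>.1 w.2 v (Submodule.mem_span_singleton_self v)
  have hT : IsSelfAdjoint T := hA.adjoint_conj S
  have hTα : algebraMap ℝ (K →L[ℂ] K) α ≤ T := by
    have h := ((ContinuousLinearMap.le_def _ _).1 hα).adjoint_conj S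
    refine (ContinuousLinearMap.le_def _ _).2 ?_
    convert h using 1
    ext k
    simp [T, Algebra.algebraMap_eq_smul_one, ← Complex.coe_smul, hSS]
  have hTβ : T ≤ algebraMap ℝ (K →L[ℂ] K) β := by
    have h := ((ContinuousLinearMap.le_def _ _).1 hβ).adjoint_conj S
    refine (ContinuousLinearMap.le_def _ _).2 ?_
    convert h using 1
    ext k
    simp [T, Algebra.algebraMap_eq_smul_one, ← Complex.coe_smul, hSS]
  set u : K := ContinuousLinearMap.adjoint S (A v) with hu
  obtain ⟨μ, hfin, hμ, hint⟩ := inner_eq_integral_of_resolvent_eq T hT α β hTα hTβ u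
  set m : ℝ := ‖v‖ ^ 2 with hm
  have hm0 : 0 < m := by positivity
  have hmC : (m : ℂ) ≠ 0 := by exact_mod_cast hm0.ne'
  have hvv : ⟪v, v⟫_ℂ = m := by rw [inner_self_eq_norm_sq_to_K]; simp [hm]
  set a : ℝ := (⟪v, A v⟫_ℂ).re with ha
  have hsymm := ContinuousLinearMap.isSelfAdjoint_iff_isSymmetric.1 hA
  have hva : ⟪v, A v⟫_ℂ = a := (hsymm.coe_re_inner_self_apply v).symm
  refine ⟨m⁻¹, -a / m ^ 2, ENNReal.ofReal (m ^ 2)⁻¹ • μ,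
    μ.smul_finite ENNReal.ofReal_ne_top, by simp [hμ],
    fun l hl x hx => ?_⟩
  -- Split `x = c v + k` with `k ⊥ v`. Compressing `(A - l) x = v` to `K` gives `(T - l) k = -c u`;
  -- pairing it with `v` gives the second equation, and eliminating `k` yields the claim.
  set c : ℂ := ⟪v, x⟫_ℂ / m with hc
  have hk0 : x - c • v ∈ K := by
    rw [Submodule.mem_orthogonal_singleton_iff_inner_right, inner_sub_right, inner_smul_right, hvv,
      hc, div_mul_cancel₀ _ hmC, sub_self]
  let k : K := ⟨x - c • v, hk0⟩
  have hAx : A x = v + l • x := by rw [← hx]; abel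
  have hTk : T k - l • k = (-c) • u := by
    have h1 : T k = ContinuousLinearMap.adjoint S (A (x - c • v)) := rfl
    have h2 : ContinuousLinearMap.adjoint S x = k := by
      rw [← hSS k]
      change _ = ContinuousLinearMap.adjoint S (x - c • v)
      simp [hSv]
    rw [h1, map_sub, map_smul, hAx, map_sub, map_add, map_smul, map_smul, hSv, h2]
    module
  have h1 := hint l hl k (-c) hTk
  have h2 : ⟪u, k⟫_ℂ = m + l * (c * m) - c * a := by
    rw [hu, ContinuousLinearMap.adjoint_inner_left]
    change ⟪A v, x - c • v⟫_ℂ = _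
    have h3 : ⟪A v, x - c • v⟫_ℂ = ⟪v, A (x - c • v)⟫_ℂ := hsymm v _
    rw [h3, map_sub, map_smul, hAx, inner_sub_right, inner_add_right, inner_smul_right,
      inner_smul_right, hvv, hva, hc, div_mul_cancel₀ _ hmC]
  have h4 : ⟪v, x⟫_ℂ = c * m := by rw [hc, div_mul_cancel₀ _ hmC]
  rw [h2] at h1
  rw [integral_smul_measure, ENNReal.toReal_ofReal (by positivity), h4, Complex.real_smul]
  push_cast
  field_simp
  linear_combination h1

-- The GNS space of `g ↦ ∫ g dσ` on `C([α, β])` plays the role of `L²(σ)`: `π e` is multiplication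
-- by `t`, `v` is the class of `1`, and `π (r l) v` solves the resolvent equation.
open scoped InnerProductSpace ComplexOrder in
theorem IsMarkov.exists_mul_eq_neg_one {α β : ℝ} {φ : ℂ → ℂ} (hφ : IsMarkov α β φ) {z : ℂ}
    (hz : z ∉ (fun t : ℝ => (t : ℂ)) '' Set.Icc α β) (hφz : φ z ≠ 0) :
    ∃ (p q : ℝ) (μ : Measure ℝ), IsFiniteMeasure μ ∧ μ (Set.Icc α β)ᶜ = 0 ∧
      ∀ l : ℂ, l ∉ (fun t : ℝ => (t : ℂ)) '' Set.Icc α β →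
        φ l * (p * l + q + ∫ t : ℝ, 1 / ((t : ℂ) - l) ∂μ) = -1 := by
  obtain ⟨σ, hfin, hσ, hφσ⟩ := hφ
  have hres : σ.restrict (Set.Icc α β) = σ := Measure.restrict_eq_self_of_ae_mem (by rwa [ae_iff])
  let X := Set.Icc α β
  have hme : MeasurableEmbedding ((↑) : X → ℝ) := MeasurableEmbedding.subtype_coe measurableSet_Icc
  let ν : Measure X := σ.comap (↑)
  have : IsFiniteMeasure ν := inferInstance
  have hi : ∀ g : C(X, ℂ), Integrable g ν := fun g =>
    g.continuous.integrable_of_hasCompactSupport (HasCompactSupport.of_compactSpace _)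
  let f : C(X, ℂ) →ₚ[ℂ] ℂ := PositiveLinearMap.mk₀
    { toFun := fun g => ∫ t, g t ∂ν
      map_add' := fun g h => integral_add (hi g) (hi h)
      map_smul' := fun r g => integral_const_mul r _ } fun g hg => integral_nonneg hg
  let π := f.gnsStarAlgHom
  let v : f.GNS := ((f.toPreGNS 1 : f.PreGNS) : f.GNS)
  let e : C(X, ℂ) := ⟨fun t => ((t : ℝ) : ℂ), by fun_prop⟩
  have hfi : ∀ g : C(X, ℂ), ⟪v, π g v⟫_ℂ = f g := fun g => by
    change ⟪v, f.gnsNonUnitalStarAlgHom g v⟫_ℂ = f g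
    rw [PositiveLinearMap.gnsNonUnitalStarAlgHom_apply_coe, UniformSpace.Completion.inner_coe,
      PositiveLinearMap.preGNS_inner_def]
    simp
  let r : (l : ℂ) → l ∉ (fun t : ℝ => (t : ℂ)) '' Set.Icc α β → C(X, ℂ) := fun l hl =>
    ⟨fun t => 1 / (((t : ℝ) : ℂ) - l), by
      refine Continuous.div (by fun_prop) (by fun_prop) fun t h => hl ⟨t, t.2, sub_eq_zero.1 h⟩⟩
  have hfr : ∀ l hl, f (r l hl) = φ l := fun l hl => by
    change ∫ t : X, 1 / (((t : ℝ) : ℂ) - l) ∂ν = _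
    rw [hφσ l hl, integral_subtype_comap measurableSet_Icc (fun t : ℝ => 1 / ((t : ℂ) - l)), hres]
  have hv : v ≠ 0 := fun h => hφz (by rw [← hfr z hz, ← hfi, h, map_zero, inner_zero_right])
  have hπ : ∀ s : ℝ, algebraMap ℝ (f.GNS →L[ℂ] f.GNS) s = π (algebraMap ℂ _ (s : ℂ)) := fun s => by
    rw [AlgHomClass.commutes]
    rfl
  have hmono : ∀ g h : C(X, ℂ), g ≤ h → π g ≤ π h := fun g h hgh => OrderHomClass.mono π hgh
  obtain ⟨p, q, μ, h1, h2, h3⟩ := exists_inner_resolvent_mul_eq_neg_one (π e)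
    (show IsSelfAdjoint (π e) from
      IsSelfAdjoint.map (show IsSelfAdjoint e from ContinuousMap.ext fun t => Complex.conj_ofReal _)
        π) α β
    (by rw [hπ]; exact hmono _ _ fun t => by simpa [e] using t.2.1)
    (by rw [hπ]; exact hmono _ _ fun t => by simpa [e] using t.2.2) v hv
  refine ⟨p, q, μ, h1, h2, fun l hl => ?_⟩
  rw [← hfr l hl, ← hfi]
  refine h3 l hl _ ?_
  have h4 : e * r l hl - l • r l hl = 1 := by
    ext t
    have : ((t : ℝ) : ℂ) - l ≠ 0 := fun h => hl ⟨t, t.2, sub_eq_zero.1 h⟩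
    simp [e, r]
    field_simp
  have h5 := congr(π $h4 v)
  simpa using h5

/-! ### The Schur step at one node. -/

open scoped ComplexConjugate in
/-- One step of the Schur algorithm: dividing out the value at `z` leaves a Markov function. -/
theorem IsMarkov.exists_step {α β : ℝ} {φ : ℂ → ℂ} (hφ : IsMarkov α β φ) {z w : ℂ}
    (hz : 0 < z.im) (hφz : φ z = w) (hw : w ≠ 0) {b : ℝ} (hb : 0 < b) :
    ∃ ψ : ℂ → ℂ, IsMarkov α β ψ ∧ ∀ l : ℂ, l ∉ (fun t : ℝ => (t : ℂ)) '' Set.Icc α β →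
      φ l * ((b : ℂ) ^ 2 * (l - z) * (l - conj z) * ψ l + stepA2 z w * l - stepA1 z w) = -1 := by
  have hzt : ∀ t : ℝ, (t : ℂ) - z ≠ 0 := fun t h => by
    have := congrArg Complex.im h
    simp at this
    exact hz.ne' this
  have hzI : z ∉ (fun t : ℝ => (t : ℂ)) '' Set.Icc α β := by
    rintro ⟨t, -, ht⟩
    exact hzt t (sub_eq_zero.2 ht)
  obtain ⟨p, q, μ, hfin, hμ, hint⟩ := hφ.exists_mul_eq_neg_one hzI (hφz ▸ hw)
  have hae : ∀ᵐ t ∂μ, t ∈ Set.Icc α β := by rwa [ae_iff]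
  have hres : μ.restrict (Set.Icc α β) = μ := Measure.restrict_eq_self_of_ae_mem hae
  have hbd : ∀ f : ℝ → ℂ, ContinuousOn f (Set.Icc α β) → Integrable f μ := fun f hf => by
    rw [← hres]
    exact hf.integrableOn_compact isCompact_Icc
  have hi1 : ∀ l, l ∉ (fun t : ℝ => (t : ℂ)) '' Set.Icc α β →
      Integrable (fun t : ℝ => 1 / ((t : ℂ) - l)) μ := fun l hl =>
    hbd _ (ContinuousOn.div (by fun_prop) (by fun_prop) fun t ht h =>
      hl ⟨t, ht, sub_eq_zero.1 h⟩)
  set g : ℝ → ℝ := fun t => (Complex.normSq ((t : ℂ) - z))⁻¹ with hg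
  have hg0 : ∀ t, 0 ≤ g t := fun t => inv_nonneg.2 (Complex.normSq_nonneg _)
  have hgc : Continuous g := Continuous.inv₀ (Complex.continuous_normSq.comp (by fun_prop))
    fun t h => hzt t (Complex.normSq_eq_zero.1 h)
  have hgC : ∀ t : ℝ, (g t : ℂ) = 1 / (((t : ℂ) - z) * (t - conj z)) := fun t => by
    simp only [hg]
    rw [Complex.ofReal_inv, Complex.normSq_eq_conj_mul_self, map_sub, Complex.conj_ofReal, one_div,
      mul_comm]
  have hzt' : ∀ t : ℝ, (t : ℂ) - conj z ≠ 0 := fun t h => hzt t <| by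
    simpa using congrArg conj h
  set N : ℝ := ∫ t, g t ∂μ with hN
  have hNC : (N : ℂ) = ∫ t, (g t : ℂ) ∂μ := integral_complex_ofReal.symm
  set F : ℂ → ℂ := fun l => ∫ t : ℝ, 1 / ((t : ℂ) - l) ∂μ with hF
  have hFim : (F z).im = z.im * N := by
    have h1 := Complex.imCLM.integral_comp_comm (hi1 z hzI)
    simp only [Complex.imCLM_apply] at h1
    rw [hF, ← h1, hN, ← integral_const_mul]
    refine integral_congr_ae (.of_forall fun t => ?_)
    simp [hg, Complex.inv_im, div_eq_mul_inv]
  have hzw : w * (p * z + q + F z) = -1 := hφz ▸ hint z hzI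
  have hw1 : 1 / w = -(p * z + q + F z) := by
    field_simp
    linear_combination hzw
  -- `N` is the integral of `|t - z|⁻²`, and `Im F(z) = N Im z`.
  have hA2 : stepA2 z w = p + N := by
    rw [stepA2, hw1, div_eq_iff hz.ne']
    simp [hFim]
    ring
  have hA1 : (stepA1 z w : ℂ) = N * z - q - F z := by
    rw [stepA1_eq z w hz.ne', hA2, hw1]
    push_cast
    ring
  set μ' := μ.withDensity fun t => ENNReal.ofReal ((b ^ 2)⁻¹ * g t) with hμ'
  refine ⟨fun l => ∫ t : ℝ, 1 / ((t : ℂ) - l) ∂μ', ⟨μ', ?_, ?_, fun l _ => rfl⟩, fun l hl => ?_⟩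
  · refine isFiniteMeasure_withDensity_ofReal (Integrable.const_mul ?_ _).hasFiniteIntegral
    have := (hbd (fun t => (g t : ℂ)) (by fun_prop)).re
    simpa using this
  · exact withDensity_absolutelyContinuous _ _ hμ
  · have hb' : (b : ℂ) ≠ 0 := by exact_mod_cast hb.ne'
    have h1 : ∫ t : ℝ, 1 / ((t : ℂ) - l) ∂μ' =
        ∫ t : ℝ, ((b : ℂ) ^ 2)⁻¹ * (g t * (1 / ((t : ℂ) - l))) ∂μ := by
      rw [hμ', integral_withDensity_eq_integral_toReal_smul (by fun_prop)
        (.of_forall fun t => ENNReal.ofReal_lt_top)]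
      refine integral_congr_ae (.of_forall fun t => ?_)
      simp only
      rw [ENNReal.toReal_ofReal (mul_nonneg (by positivity) (hg0 t)), Complex.real_smul]
      push_cast
      ring
    -- Integrates `1/(t-l) - 1/(t-z) - (l-z) g(t) = (l-z)(l - conj z) g(t)/(t-l)`, where `g(t) =
    -- |t-z|⁻²`.
    have h2 : (b : ℂ) ^ 2 * (l - z) * (l - conj z) * ∫ t : ℝ, 1 / ((t : ℂ) - l) ∂μ' =
        F l - F z - (l - z) * N := by
      have hsub : Integrable (fun t : ℝ => 1 / ((t : ℂ) - l) - 1 / ((t : ℂ) - z)) μ :=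
        (hi1 l hl).sub (hi1 z hzI)
      have hmul : Integrable (fun t : ℝ => (l - z) * (g t : ℂ)) μ := hbd _ (by fun_prop)
      rw [h1, integral_const_mul, hNC, ← integral_const_mul (l - z),
        ← integral_sub (hi1 l hl) (hi1 z hzI), ← integral_sub hsub hmul,
        show ∀ I : ℂ, (b : ℂ) ^ 2 * (l - z) * (l - conj z) * (((b : ℂ) ^ 2)⁻¹ * I) =
          (l - z) * (l - conj z) * I from fun I => by field_simp,
        ← integral_const_mul]
      refine integral_congr_ae (hae.mono fun t ht => ?_)
      have h3 : (t : ℂ) - l ≠ 0 := fun h => hl ⟨t, ht, sub_eq_zero.1 h⟩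
      have h4 := hzt t
      have h5 := hzt' t
      simp only [hgC]
      field_simp
      ring
    have h3 := hint l hl
    rw [h2, hA1, hA2]
    push_cast
    rw [← h3]
    ring

/-! ### Matrix factors and their product. -/

theorem factorW_mulVec_eq_smul {z w : ℕ → ℂ} {b : ℕ → ℝ} {j : ℕ} {l x y : ℂ} (hb : 0 < b j)
    (hl : l ≠ starRingEnd ℂ (z j))
    (h : x * ((b j : ℂ) ^ 2 * (l - z j) * (l - starRingEnd ℂ (z j)) * y + coeffA2 z w b j * l
      - coeffA1 z w b j) = -1) :
    ∃ c : ℂ, c ≠ 0 ∧ factorW z w b j l *ᵥ ![y, 1] = c • ![x, 1] := by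
  have hb' : (b j : ℂ) ≠ 0 := by exact_mod_cast hb.ne'
  have hl' : l - starRingEnd ℂ (z j) ≠ 0 := sub_ne_zero.2 hl
  set c : ℂ := (b j : ℂ) * (l - z j) * y + (coeffA2 z w b j * l - coeffA1 z w b j) /
    ((b j : ℂ) * (l - starRingEnd ℂ (z j))) with hc
  -- The first row of the factor; its right side is nonzero, which forces `c ≠ 0`.
  have h1 : c * x = -(1 / ((b j : ℂ) * (l - starRingEnd ℂ (z j)))) := by
    rw [hc]
    field_simp
    linear_combination h
  have hc0 : c ≠ 0 := fun h0 => by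
    rw [h0, zero_mul] at h1
    exact neg_ne_zero.2 (one_div_ne_zero (mul_ne_zero hb' hl')) h1.symm
  refine ⟨c, hc0, ?_⟩
  ext i
  fin_cases i
  · simp [factorW, h1]
  · simp [factorW, hc, mul_comm y]

/-- The clause on values is carried through the induction so that nondegeneracy supplies the nonzero
value needed at the next node. -/
theorem exists_isMarkov_prod_factorW_mulVec {α β : ℝ} {n : ℕ} {z w : ℕ → ℂ}
    (hz : ∀ k ≤ n, 0 < (z k).im) (hinj : ∀ i ≤ n, ∀ j ≤ n, z i = z j → i = j)
    {b : ℕ → ℝ} (hb : ∀ j ≤ n, 0 < b j) (hnd : NondegenerateNP n z w b)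
    {φ : ℂ → ℂ} (hφ : SolvesNP α β n z w φ) (m : ℕ) (hm : m ≤ n + 1) :
    ∃ τ : ℂ → ℂ, IsMarkov α β τ ∧ (∀ k ≤ n, m ≤ k → τ (z k) = processValue z w b m k) ∧
      ∀ l : ℂ, l ∉ (fun t : ℝ => (t : ℂ)) '' Set.Icc α β →
        (∀ j ≤ n, l ≠ starRingEnd ℂ (z j)) →
        ∃ c : ℂ, c ≠ 0 ∧
          ((List.range m).map fun j => factorW z w b j l).prod *ᵥ ![τ l, 1] = c • ![φ l, 1] := by
  induction m with
  | zero => exact ⟨φ, hφ.1, fun k hk _ => hφ.2 k hk, fun l _ _ => ⟨1, one_ne_zero, by simp⟩⟩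
  | succ m ih =>
    obtain ⟨τ, hτ, hval, hprod⟩ := ih (by omega)
    have hmn : m ≤ n := by omega
    obtain ⟨ψ, hψ, hstep⟩ := hτ.exists_step (hz m hmn) (hval m hmn le_rfl) (hnd m hmn) (hb m hmn)
    refine ⟨ψ, hψ, fun k hk hmk => ?_, fun l hl hlz => ?_⟩
    · have hzk : z k ∉ (fun t : ℝ => (t : ℂ)) '' Set.Icc α β := by
        rintro ⟨t, -, ht⟩
        have := hz k hk
        rw [← ht] at this
        simp at this
      have h1 := hstep (z k) hzk
      have hb' : (b m : ℂ) ≠ 0 := by exact_mod_cast (hb m hmn).ne'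
      have h2 : z k - z m ≠ 0 := fun h => by
        have := hinj k hk m hmn (sub_eq_zero.1 h)
        omega
      have h3 : z k - starRingEnd ℂ (z m) ≠ 0 := fun h => by
        have h4 := congrArg Complex.im h
        have := hz k hk
        have := hz m hmn
        simp at h4
        linarith
      rw [hval k hk (by omega)] at h1
      have h4 : processValue z w b m k ≠ 0 := fun h => by simp [h] at h1
      rw [processValue, eq_div_iff (by positivity)]
      field_simp
      linear_combination h1
    · obtain ⟨c, hc, h1⟩ := hprod l hl hlz
      obtain ⟨d, hd, h2⟩ := factorW_mulVec_eq_smul (w := w) (hb m hmn) (hlz m hmn) (hstep l hl)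
      refine ⟨d * c, mul_ne_zero hd hc, ?_⟩
      rw [List.range_succ, List.map_append, List.prod_append, List.map_singleton,
        List.prod_singleton, ← mulVec_mulVec, h2, mulVec_smul, h1, smul_smul]

theorem mainTheorem4 (α β : ℝ) (hαβ : α ≤ β) (n : ℕ) (z w : ℕ → ℂ)
    (hz : ∀ k ≤ n, 0 < (z k).im)
    (hinj : ∀ i ≤ n, ∀ j ≤ n, z i = z j → i = j)
    (b : ℕ → ℝ) (hb : ∀ j ≤ n, 0 < b j)
    (hnd : NondegenerateNP n z w b)
    (φ : ℂ → ℂ) (hφ : SolvesNP α β n z w φ) :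
    ∃ τ : ℂ → ℂ, IsMarkovOrZero α β τ ∧
      ∀ l : ℂ, l ∉ (fun t : ℝ => (t : ℂ)) '' Set.Icc α β →
        (∀ j ≤ n, l ≠ starRingEnd ℂ (z j)) →
        productW n z w b l 1 0 * τ l + productW n z w b l 1 1 ≠ 0 ∧
        φ l = (productW n z w b l 0 0 * τ l + productW n z w b l 0 1) /
          (productW n z w b l 1 0 * τ l + productW n z w b l 1 1) := by
  obtain ⟨τ, hτ, -, h⟩ :=
    exists_isMarkov_prod_factorW_mulVec hz hinj hb hnd hφ (n + 1) le_rfl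
  -- `IsMarkov` admits the zero measure, so the first alternative also covers `τ = 0`.
  refine ⟨τ, .inl hτ, fun l hl hlz => ?_⟩
  obtain ⟨c, hc, h1⟩ := h l hl hlz
  change productW n z w b l *ᵥ _ = _ at h1
  have e0 := congrFun h1 0
  have e1 := congrFun h1 1
  simp only [mulVec, dotProduct, Fin.sum_univ_two, cons_val_zero, cons_val_one, mul_one,
    Pi.smul_apply, smul_eq_mul] at e0 e1
  -- The denominator is the projective factor `c ≠ 0`, and the numerator is `c * φ l`.
  rw [e0, e1]
  exact ⟨hc, by field_simp⟩
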